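/- Let $C>0$, let $g=(g_1,\dots,g_m):\mathbb R^l\to\mathbb R^m$ be differentiable, and let $\varphi(z):=C\,L_{0/1}(g(z))$, where $L_{0/1}(u):=\#\{i: u_i>0\}$ for $u\in\mathbb R^m$. Fix $\bar z\in\mathbb R^l$ and put $I:=\{i: g_i(\bar z)>0\}$, $\overline I:=\{1,\dots,m\}\setminus I$, $g_{\overline I}:=(g_i)_{i\in\overline I}$, and $\Theta:=\{z\in\mathbb R^l: g_i(z)\le 0 \text{ for all } i\in\overline I\}$. All spaces carry the Euclidean norm. For $f:\mathbb R^l\to\mathbb R$, the regular subdifferential is $$\widehat\partial f(x):=\Big\{v:\ \liminf_{x\ne z\to x}\frac{f(z)-f(x)-\langle v,z-x\rangle}{\|z-x\|}\ge 0\Big\},$$ and the limiting subdifferential $\partial f(x)$ is the set of all limits $v=\lim_k v^k$ with $v^k\in\widehat\partial f(z^k)$, $z^k\to x$ and $f(z^k)\to f(x)$. For a set $S$ in a Euclidean space and $x\in S$, the regular normal cone is $$\widehat{\mathcal N}_S(x):=\Big\{v:\ \limsup_{S\ni z\to x,\ z\neq x}\frac{\langle v,z-x\rangle}{\|z-x\|}\le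 0\Big\},$$ and the limiting normal cone $\mathcal N_S(x)$ is the set of all limits $v=\lim_k v^k$ with $v^k\in\widehat{\mathcal N}_S(z^k)$, $z^k\in S$ and $z^k\to x$. Then: (i) $\widehat\partial\varphi(\bar z)=\widehat{\mathcal N}_\Theta(\bar z)$ and $\partial\varphi(\bar z)=\mathcal N_\Theta(\bar z)$. (ii) Suppose that the multifunction $\mathcal G(z):=g_{\overline I}(z)-\mathbb R_-^{|\overline I|}$ is metrically subregular at $\bar z$ for the origin, that is, there are $\kappa\ge 0$ and $\delta>0$ with $\operatorname{dist}(z,\mathcal G^{-1}(0))\le\kappa\,\operatorname{dist}(0,\mathcal G(z))$ whenever $\|z-\bar z\|<\delta$. Then $$\widehat\partial\varphi(\bar z)=\nabla g_{\overline I}(\bar z)\,\mathcal N_{\mathbb R_-^{|\overline I|}}\big(g_{\overline I}(\bar z)\big),$$ where $\nabla g_{\overline I}(\bar z)$ is the transpose of the Jacobian of $g_{\overline I}$ at $\bar z$. If moreover the Jacobian of $g_{\overline I}$ is continuous at $\bar z$ (in particular, if $g$ is continuously differentiable), then also $$\partial\varphi(\bar z)=\nabla g_{\overline I}(\bar z)\,\mathcal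 N_{\mathbb R_-^{|\overline I|}}\big(g_{\overline I}(\bar z)\big).$$ -/

import Mathlib

open Filter Topology

namespace ZeroOneLoss

noncomputable section

section VariationalAnalysis

variable {E F : Type*} [NormedAddCommGroup E] [InnerProductSpace ℝ E]

/-- Regular (Fréchet) subdifferential of a real-valued function `f` at `x`. The lower limit is
taken in the extended reals, because the difference quotient may be unbounded. -/
def regularSubdiff (f : E → ℝ) (x : E) : Set E :=
  {v | (0 : EReal) ≤
    liminf (fun z => (((f z - f x - inner ℝ v (z - x)) / ‖z - x‖ : ℝ) : EReal)) (𝓝[≠] x)}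

/-- Limiting (Mordukhovich) subdifferential of a real-valued function `f` at `x`. -/
def limitingSubdiff (f : E → ℝ) (x : E) : Set E :=
  {v | ∃ z w : ℕ → E, Tendsto z atTop (𝓝 x) ∧ Tendsto (fun k => f (z k)) atTop (𝓝 (f x)) ∧
    (∀ k, w k ∈ regularSubdiff f (z k)) ∧ Tendsto w atTop (𝓝 v)}

/-- Regular (Fréchet) normal cone to `S` at a point `x ∈ S`; the upper limit is over
`z → x` with `z ∈ S`, `z ≠ x`, so the cone is the whole space at an isolated point of `S`. -/
def regularNormalCone (S : Set E) (x : E) : Set E :=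
  {v | limsup (fun z => ((inner ℝ v (z - x) / ‖z - x‖ : ℝ) : EReal)) (𝓝[S \ {x}] x) ≤ 0}

/-- Limiting (Mordukhovich) normal cone to `S` at a point `x ∈ S`. -/
def limitingNormalCone (S : Set E) (x : E) : Set E :=
  {v | ∃ z w : ℕ → E, Tendsto z atTop (𝓝 x) ∧ (∀ k, z k ∈ S) ∧
    (∀ k, w k ∈ regularNormalCone S (z k)) ∧ Tendsto w atTop (𝓝 v)}

/-- Metric subregularity of the multifunction `G` at `x` for `p ∈ G x`. Points `z` with
`G z = ∅` impose no condition, since the distance to the empty set is `+∞`. -/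
def MetricallySubregularAt [NormedAddCommGroup F] (G : E → Set F) (x : E) (p : F) : Prop :=
  p ∈ G x ∧ ∃ κ : ℝ, 0 ≤ κ ∧ ∃ δ : ℝ, 0 < δ ∧ ∀ z ∈ Metric.ball x δ, (G z).Nonempty →
    Metric.infDist z {y | p ∈ G y} ≤ κ * Metric.infDist p (G z)

end VariationalAnalysis

/-- The scalar loss: `1` if `t > 0` and `0` if `t ≤ 0`. -/
def zeroOne (t : ℝ) : ℝ := if 0 < t then 1 else 0

/-- The loss of a vector: the sum of the scalar losses of its entries. -/
def zeroOneSum {m : ℕ} (u : EuclideanSpace ℝ (Fin m)) : ℝ := ∑ i, zeroOne (u i)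

/-- The set of indices of the positive entries of `u`. -/
def posIdx {m : ℕ} (u : EuclideanSpace ℝ (Fin m)) : Finset (Fin m) :=
  Finset.univ.filter fun i => 0 < u i

/-- The subvector `u_J` of `u` with the entries whose index lies in `J`. -/
def subvec {m : ℕ} (J : Finset (Fin m)) (u : EuclideanSpace ℝ (Fin m)) :
    EuclideanSpace ℝ J :=
  WithLp.toLp 2 fun i => u i

/-- The nonpositive orthant. -/
def nonposOrthant (ι : Type*) : Set (EuclideanSpace ℝ ι) := {u | ∀ i, u i ≤ 0}

/-- `∇h(z)`, the transpose of the Jacobian of `h` at `z`, as a linear map. -/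
def gradMap {ι κ : Type*} [Fintype ι] [Fintype κ]
    (h : EuclideanSpace ℝ ι → EuclideanSpace ℝ κ) (z : EuclideanSpace ℝ ι) :
    EuclideanSpace ℝ κ →L[ℝ] EuclideanSpace ℝ ι :=
  ContinuousLinearMap.adjoint (fderiv ℝ h z)

end

end ZeroOneLoss

/-! Entries of `g` positive at `zbar` stay positive nearby, so locally `φ` equals `φ zbar` on `Θ`
and is at least `φ zbar + C` off it. Such a jump absorbs every first-order term, so `φ` has the
subgradients of the indicator of `Θ`; this is (i).

For (ii), subregularity yields the error bound `dist(z, Θ) ≤ κ ‖h(z)₊‖` with `h = gJ`. Moving `x + t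
d` back to `Θ` and letting `t → 0` bounds `⟨v, d⟩`, for a regular normal `v`, by `κ ‖v‖` times the
active positive part of `h'(x) d` (`inner_le_of_mem_regularNormalCone`). That bound is the support
function of the compact convex set of images of multipliers of norm at most `κ ‖v‖`, so separation
places `v` in this set (`exists_multiplier_of_inner_le`). The norm bound then supplies the
compactness needed for limiting normals. -/

namespace ZeroOneLoss

/-! ### Epsilon forms of subgradients and normals; functions with a jump -/

section VariationalAnalysis

variable {E : Type*} [NormedAddCommGroup E] [InnerProductSpace ℝ E]

/-- Clearing the denominator makes the inequality trivial at `z = x`, so the full neighbourhood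
filter can be used. -/
theorem mem_regularSubdiff_iff {f : E → ℝ} {x v : E} :
    v ∈ regularSubdiff f x ↔
      ∀ ε > 0, ∀ᶠ z in 𝓝 x, -ε * ‖z - x‖ ≤ f z - f x - inner ℝ v (z - x) := by
  have key : ∀ ε : ℝ, (∀ᶠ z in 𝓝 x, -ε * ‖z - x‖ ≤ f z - f x - inner ℝ v (z - x)) ↔
      ∀ᶠ z in 𝓝[≠] x, -ε ≤ (f z - f x - inner ℝ v (z - x)) / ‖z - x‖ := by
    intro ε
    rw [eventually_nhdsWithin_iff]
    refine eventually_congr (Eventually.of_forall fun z => ?_)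
    by_cases hz : z = x
    · simp [hz]
    · have : 0 < ‖z - x‖ := norm_pos_iff.2 (sub_ne_zero.2 hz)
      simp [hz, le_div_iff₀ this]
  simp only [regularSubdiff, Set.mem_ofPred_eq]
  constructor
  · intro h ε hε
    rw [key]
    have hlt : ((-ε : ℝ) : EReal) < 0 := by exact_mod_cast neg_lt_zero.2 hε
    filter_upwards [eventually_lt_of_lt_liminf (hlt.trans_le h)] with z hz
    exact (EReal.coe_lt_coe_iff.1 hz).le
  · intro h
    refine EReal.ge_of_forall_gt_iff_ge.1 fun c hc => ?_
    have hc' : c < 0 := by exact_mod_cast hc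
    refine le_liminf_of_le (by isBoundedDefault) ?_
    filter_upwards [(key (-c)).1 (h (-c) (by linarith))] with z hz
    rw [neg_neg] at hz
    exact EReal.coe_le_coe_iff.2 hz

theorem mem_regularNormalCone_iff {S : Set E} {x v : E} :
    v ∈ regularNormalCone S x ↔
      ∀ ε > 0, ∀ᶠ z in 𝓝 x, z ∈ S → inner ℝ v (z - x) ≤ ε * ‖z - x‖ := by
  have key : ∀ ε : ℝ, (∀ᶠ z in 𝓝 x, z ∈ S → inner ℝ v (z - x) ≤ ε * ‖z - x‖) ↔
      ∀ᶠ z in 𝓝[S \ {x}] x, inner ℝ v (z - x) / ‖z - x‖ ≤ ε := by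
    intro ε
    rw [eventually_nhdsWithin_iff]
    refine eventually_congr (Eventually.of_forall fun z => ?_)
    by_cases hz : z = x
    · simp [hz]
    · have : 0 < ‖z - x‖ := norm_pos_iff.2 (sub_ne_zero.2 hz)
      simp [hz, div_le_iff₀ this]
  simp only [regularNormalCone, Set.mem_ofPred_eq]
  constructor
  · intro h ε hε
    rw [key]
    have hlt : (0 : EReal) < ((ε : ℝ) : EReal) := by exact_mod_cast hε
    filter_upwards [eventually_lt_of_limsup_lt (h.trans_lt hlt)] with z hz
    exact (EReal.coe_lt_coe_iff.1 hz).le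
  · intro h
    refine EReal.le_of_forall_lt_iff_le.1 fun c hc => ?_
    have hc' : 0 < c := by exact_mod_cast hc
    refine limsup_le_of_le (by isBoundedDefault) ?_
    filter_upwards [(key c).1 (h c hc')] with z hz
    exact EReal.coe_le_coe_iff.2 hz

theorem regularNormalCone_subset_limitingNormalCone {S : Set E} {x : E} (hx : x ∈ S) :
    regularNormalCone S x ⊆ limitingNormalCone S x := fun v hv =>
  ⟨fun _ => x, fun _ => v, tendsto_const_nhds, fun _ => hx, fun _ => hv, tendsto_const_nhds⟩

/-- A function that is locally constant on `S` and jumps by at least `c > 0` off `S` has the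
regular subgradients of the indicator function of `S`. -/
theorem regularSubdiff_eq_regularNormalCone_of_jump {f : E → ℝ} {S : Set E} {x : E} {c : ℝ}
    (hc : 0 < c) (h : ∀ᶠ z in 𝓝 x, (z ∈ S → f z = f x) ∧ (z ∉ S → f x + c ≤ f z)) :
    regularSubdiff f x = regularNormalCone S x := by
  ext v
  rw [mem_regularSubdiff_iff, mem_regularNormalCone_iff]
  refine forall₂_congr fun ε hε => ⟨fun H => ?_, fun H => ?_⟩
  · filter_upwards [H, h] with z hz hfz hzS
    rw [hfz.1 hzS] at hz
    linarith
  · have hsmall : ∀ᶠ z in 𝓝 x, inner ℝ v (z - x) < c := by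
      have : Tendsto (fun z => inner ℝ v (z - x)) (𝓝 x) (𝓝 (inner ℝ v (x - x))) :=
        Continuous.tendsto (by fun_prop) x
      rw [sub_self, inner_zero_right] at this
      exact this.eventually_lt_const hc
    filter_upwards [H, h, hsmall] with z hz hfz hvz
    by_cases hzS : z ∈ S
    · rw [hfz.1 hzS]
      linarith [hz hzS]
    · have := hfz.2 hzS
      have : 0 ≤ ε * ‖z - x‖ := by positivity
      linarith

/-- Convergence of values `f (z k) → f x` rules out the jump, so `z k` eventually lies in `S`. The
jump hypothesis is inherited by nearby points of `S`, where the regular objects therefore agree. -/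
theorem limitingSubdiff_eq_limitingNormalCone_of_jump {f : E → ℝ} {S : Set E} {x : E} {c : ℝ}
    (hc : 0 < c) (h : ∀ᶠ z in 𝓝 x, (z ∈ S → f z = f x) ∧ (z ∉ S → f x + c ≤ f z)) :
    limitingSubdiff f x = limitingNormalCone S x := by
  have hloc : ∀ᶠ y in 𝓝 x, y ∈ S →
      f y = f x ∧ regularSubdiff f y = regularNormalCone S y := by
    filter_upwards [h, h.eventually_nhds] with y hy hy' hyS
    refine ⟨hy.1 hyS, regularSubdiff_eq_regularNormalCone_of_jump hc ?_⟩
    rwa [hy.1 hyS]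
  ext v
  constructor
  · rintro ⟨z, w, hz, hfz, hw, hwv⟩
    have hev : ∀ᶠ k in atTop, z k ∈ S ∧ regularSubdiff f (z k) = regularNormalCone S (z k) := by
      filter_upwards [hz.eventually h, hz.eventually hloc,
        hfz.eventually_lt_const (lt_add_of_pos_right _ hc)] with k hk hk' hlt
      have hkS : z k ∈ S := by
        by_contra hn
        exact (hk.2 hn).not_gt hlt
      exact ⟨hkS, (hk' hkS).2⟩
    obtain ⟨N, hN⟩ := eventually_atTop.1 hev
    refine ⟨fun k => z (k + N), fun k => w (k + N), (tendsto_add_atTop_iff_nat N).2 hz,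
      fun k => (hN _ (Nat.le_add_left _ _)).1, fun k => ?_, (tendsto_add_atTop_iff_nat N).2 hwv⟩
    rw [← (hN _ (Nat.le_add_left _ _)).2]
    exact hw _
  · rintro ⟨z, w, hz, hzS, hw, hwv⟩
    obtain ⟨N, hN⟩ := eventually_atTop.1 (hz.eventually hloc)
    refine ⟨fun k => z (k + N), fun k => w (k + N), (tendsto_add_atTop_iff_nat N).2 hz,
      ?_, fun k => ?_, (tendsto_add_atTop_iff_nat N).2 hwv⟩
    · simp only [(hN _ (Nat.le_add_left _ _) (hzS _)).1]
      exact tendsto_const_nhds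
    · rw [(hN _ (Nat.le_add_left _ _) (hzS _)).2]
      exact hw _

end VariationalAnalysis

/-! ### Normal cones of the nonpositive orthant -/

section Orthant

variable {ι : Type*}

/-- The multipliers at `u`: nonnegative vectors that vanish where `u` is negative. -/
def multipliers (u : EuclideanSpace ℝ ι) : Set (EuclideanSpace ℝ ι) :=
  {y | ∀ i, 0 ≤ y i ∧ (u i < 0 → y i = 0)}

/-- The multiplier conditions pass to the limit in both the base point and the multiplier. -/
theorem mem_multipliers_of_tendsto {u y : EuclideanSpace ℝ ι} {z w : ℕ → EuclideanSpace ℝ ι}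
    (hz : Tendsto z atTop (𝓝 u)) (hw : Tendsto w atTop (𝓝 y))
    (h : ∀ k, w k ∈ multipliers (z k)) : y ∈ multipliers u := by
  intro i
  have hcoord : ∀ {a : ℕ → EuclideanSpace ℝ ι} {b : EuclideanSpace ℝ ι},
      Tendsto a atTop (𝓝 b) → Tendsto (fun k => a k i) atTop (𝓝 (b i)) := fun ha =>
    ((EuclideanSpace.proj (𝕜 := ℝ) i).continuous.tendsto _).comp ha
  refine ⟨ge_of_tendsto' (hcoord hw) fun k => (h k i).1, fun hi => ?_⟩
  refine tendsto_nhds_unique (hcoord hw) (tendsto_const_nhds.congr' ?_)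
  filter_upwards [(hcoord hz).eventually_lt_const hi] with k hk
  exact ((h k i).2 hk).symm

theorem convex_multipliers (u : EuclideanSpace ℝ ι) : Convex ℝ (multipliers u) := by
  intro x hx y hy a b ha hb _ i
  simp only [PiLp.add_apply, PiLp.smul_apply, smul_eq_mul]
  refine ⟨add_nonneg (mul_nonneg ha (hx i).1) (mul_nonneg hb (hy i).1), fun hi => ?_⟩
  simp [(hx i).2 hi, (hy i).2 hi]

/-- The componentwise positive part. -/
noncomputable def posEntries (p : EuclideanSpace ℝ ι) : EuclideanSpace ℝ ι :=
  WithLp.toLp 2 fun i => max (p i) 0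

open Classical in
/-- The positive part of `p`, restricted to the entries where `u` is not negative. -/
noncomputable def activePosEntries (u p : EuclideanSpace ℝ ι) : EuclideanSpace ℝ ι :=
  WithLp.toLp 2 fun i => if u i < 0 then 0 else max (p i) 0

theorem activePosEntries_mem_multipliers (u p : EuclideanSpace ℝ ι) :
    activePosEntries u p ∈ multipliers u := by
  intro i
  by_cases hi : u i < 0 <;> simp [activePosEntries, hi]

variable [Fintype ι]

theorem isClosed_multipliers (u : EuclideanSpace ℝ ι) : IsClosed (multipliers u) :=
  isSeqClosed_iff_isClosed.1 fun _ _ hw hy =>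
    mem_multipliers_of_tendsto tendsto_const_nhds hy hw

theorem multipliers_subset_regularNormalCone {u : EuclideanSpace ℝ ι}
    (hu : u ∈ nonposOrthant ι) :
    multipliers u ⊆ regularNormalCone (nonposOrthant ι) u := by
  intro y hy
  rw [mem_regularNormalCone_iff]
  refine fun ε hε => Eventually.of_forall fun z hz => ?_
  have : inner ℝ y (z - u) ≤ 0 := by
    rw [PiLp.inner_apply]
    refine Finset.sum_nonpos fun i _ => ?_
    simp only [RCLike.inner_apply, conj_trivial, PiLp.sub_apply]
    rcases (hu i).lt_or_eq with h | h
    · simp [(hy i).2 h]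
    · rw [h, sub_zero]
      exact mul_nonpos_of_nonpos_of_nonneg (hz i) (hy i).1
  exact this.trans (by positivity)

theorem regularNormalCone_nonposOrthant_subset {u : EuclideanSpace ℝ ι}
    (hu : u ∈ nonposOrthant ι) :
    regularNormalCone (nonposOrthant ι) u ⊆ multipliers u := by
  classical
  intro y hy i
  rw [mem_regularNormalCone_iff] at hy
  have hlim : ∀ s : ℝ, Tendsto (fun t : ℝ => u + (t * s) • EuclideanSpace.single i (1 : ℝ))
      (𝓝[>] 0) (𝓝 u) := by
    intro s
    have : Tendsto (fun t : ℝ => u + (t * s) • EuclideanSpace.single i (1 : ℝ))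
      (𝓝 0) (𝓝 (u + ((0 : ℝ) * s) • EuclideanSpace.single i (1 : ℝ))) :=
      Continuous.tendsto (by fun_prop) 0
    rw [zero_mul, zero_smul, add_zero] at this
    exact this.mono_left nhdsWithin_le_nhds
  -- Tests normality along `± e_i`: the direction `-e_i` is always feasible, `+e_i` only when `u i <
  -- 0`.
  have main : ∀ s : ℝ, |s| = 1 → (∀ᶠ t : ℝ in 𝓝[>] 0, u i + t * s ≤ 0) → s * y i ≤ 0 := by
    intro s hs hmem
    refine le_of_forall_pos_le_add fun ε hε => ?_
    obtain ⟨t, ht, htm, ht0⟩ :=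
      (((hlim s).eventually (hy ε hε)).and (hmem.and self_mem_nhdsWithin)).exists
    have ht0 : 0 < t := ht0
    have hS : u + (t * s) • EuclideanSpace.single i (1 : ℝ) ∈ nonposOrthant ι := by
      intro j
      by_cases hj : j = i
      · subst hj
        simpa using htm
      · simpa [hj] using hu j
    have := ht hS
    rw [add_sub_cancel_left, inner_smul_right, norm_smul, EuclideanSpace.inner_single_right,
      PiLp.norm_single] at this
    simp only [conj_trivial, one_mul, norm_one, mul_one, Real.norm_eq_abs, abs_mul, hs,
      abs_of_pos ht0] at this
    rw [zero_add]
    refine le_of_mul_le_mul_left ?_ ht0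
    linarith
  constructor
  · have := main (-1) (by simp) (by
      filter_upwards [self_mem_nhdsWithin] with t ht
      have ht : 0 < t := ht
      linarith [hu i])
    linarith
  · intro hi
    have h1 := main (-1) (by simp) (by
      filter_upwards [self_mem_nhdsWithin] with t ht
      have ht : 0 < t := ht
      linarith [hu i])
    have h2 := main 1 (by simp) (by
      have : ∀ᶠ t : ℝ in 𝓝 0, t < -u i := eventually_lt_nhds (by linarith)
      filter_upwards [this.filter_mono nhdsWithin_le_nhds] with t ht
      linarith)
    linarith

theorem limitingNormalCone_nonposOrthant {u : EuclideanSpace ℝ ι} (hu : u ∈ nonposOrthant ι) :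
    limitingNormalCone (nonposOrthant ι) u = multipliers u := by
  refine Set.Subset.antisymm ?_ ((multipliers_subset_regularNormalCone hu).trans
    (regularNormalCone_subset_limitingNormalCone hu))
  rintro y ⟨z, w, hz, hzS, hw, hwy⟩
  exact mem_multipliers_of_tendsto hz hwy fun k =>
    regularNormalCone_nonposOrthant_subset (hzS k) (hw k)

/-- The active positive part is the projection of `p` onto the cone of multipliers, hence this
identity. -/
theorem inner_activePosEntries (u p : EuclideanSpace ℝ ι) :
    inner ℝ p (activePosEntries u p) = ‖activePosEntries u p‖ ^ 2 := by
  rw [← real_inner_self_eq_norm_sq, PiLp.inner_apply, PiLp.inner_apply]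
  refine Finset.sum_congr rfl fun i _ => ?_
  simp only [RCLike.inner_apply, conj_trivial, activePosEntries]
  split_ifs
  · simp
  · rcases le_total (p i) 0 with h | h <;> simp [h]

end Orthant

/-! ### Normals to an inequality system under an error bound -/

section ConstraintSystem

variable {E : Type*} [NormedAddCommGroup E] [InnerProductSpace ℝ E]
variable {ι : Type*} [Fintype ι]

/-- The feasible set of the inequality system `h z ≤ 0`. -/
def feasible {E ι : Type*} (h : E → EuclideanSpace ℝ ι) : Set E := {z | ∀ i, h z i ≤ 0}

/-- The positive part of `h` along a ray from a feasible point, to first order. -/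
theorem tendsto_posEntries_ray {h : E → EuclideanSpace ℝ ι} {x d : E} (hx : x ∈ feasible h)
    (hd : DifferentiableAt ℝ h x) :
    Tendsto (fun t : ℝ => t⁻¹ • posEntries (h (x + t • d))) (𝓝[>] 0)
      (𝓝 (activePosEntries (h x) (fderiv ℝ h x d))) := by
  have hline : HasDerivAt (fun t : ℝ => h (x + t • d)) (fderiv ℝ h x d) 0 :=
    (HasFDerivAt.hasLineDerivAt hd.hasFDerivAt d)
  have hcoord : ∀ i, Tendsto (fun t : ℝ => t⁻¹ * max (h (x + t • d) i) 0) (𝓝[>] 0)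
      (𝓝 (activePosEntries (h x) (fderiv ℝ h x d) i)) := by
    intro i
    by_cases hi : h x i < 0
    · have hcont : Tendsto (fun t : ℝ => h (x + t • d) i) (𝓝 0) (𝓝 (h x i)) := by
        have := ((EuclideanSpace.proj (𝕜 := ℝ) i).continuous.tendsto _).comp
          hline.continuousAt.tendsto
        rw [zero_smul, add_zero] at this
        exact this
      have hval : activePosEntries (h x) (fderiv ℝ h x d) i = 0 := by simp [activePosEntries, hi]
      rw [hval]
      refine tendsto_const_nhds.congr' ?_
      filter_upwards [(hcont.eventually_lt_const hi).filter_mono nhdsWithin_le_nhds] with t ht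
      simp [max_eq_right ht.le]
    · have hi0 : h x i = 0 := le_antisymm (hx i) (not_lt.1 hi)
      have hval : activePosEntries (h x) (fderiv ℝ h x d) i = max (fderiv ℝ h x d i) 0 := by
        simp [activePosEntries, hi]
      rw [hval]
      have hslope := ((EuclideanSpace.proj (𝕜 := ℝ) i).continuous.tendsto _).comp
        (hline.tendsto_slope_zero_right)
      have hmax := hslope.max (tendsto_const_nhds (x := (0 : ℝ)))
      refine hmax.congr' ?_
      filter_upwards [self_mem_nhdsWithin] with t ht
      have ht : 0 < t := ht
      have : 0 ≤ t⁻¹ := by positivity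
      rw [mul_max_of_nonneg _ _ this]
      simp [hi0]
  have hpi := (PiLp.continuous_toLp 2 (fun _ : ι => ℝ)).tendsto _ |>.comp
    (tendsto_pi_nhds.2 hcoord)
  exact hpi

/-- Under an error bound with constant `κ`, a regular normal `v` of the feasible set is bounded,
as a linear functional, by `κ ‖v‖` times the linearized constraint violation. -/
theorem inner_le_of_mem_regularNormalCone {h : E → EuclideanSpace ℝ ι} {x : E}
    (hx : x ∈ feasible h) (hd : DifferentiableAt ℝ h x) {κ : ℝ}
    (hbound : ∀ᶠ z in 𝓝 x, Metric.infDist z (feasible h) ≤ κ * ‖posEntries (h z)‖)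
    {v : E} (hv : v ∈ regularNormalCone (feasible h) x) (d : E) :
    inner ℝ v d ≤ κ * ‖v‖ * ‖activePosEntries (h x) (fderiv ℝ h x d)‖ := by
  rw [mem_regularNormalCone_iff] at hv
  set q := ‖activePosEntries (h x) (fderiv ℝ h x d)‖ with hq
  set r : ℝ → ℝ := fun t => ‖t⁻¹ • posEntries (h (x + t • d))‖ with hr
  have hrq : Tendsto r (𝓝[>] 0) (𝓝 q) := (tendsto_posEntries_ray hx hd).norm
  have hray : Tendsto (fun t : ℝ => x + t • d) (𝓝[>] 0) (𝓝 x) := by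
    have : Tendsto (fun t : ℝ => x + t • d) (𝓝 0) (𝓝 (x + (0 : ℝ) • d)) :=
      Continuous.tendsto (by fun_prop) 0
    rw [zero_smul, add_zero] at this
    exact this.mono_left nhdsWithin_le_nhds
  have ht0 : Tendsto (fun t : ℝ => t) (𝓝[>] 0) (𝓝 0) := tendsto_id.mono_left nhdsWithin_le_nhds
  have step : ∀ ε > 0, inner ℝ v d ≤ ‖v‖ * (κ * q + ε) + ε * (‖d‖ + (κ * q + ε)) := by
    intro ε hε
    -- A nearest feasible point may not exist; the slack `t * ε` survives division by `t` as `ε`,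
    -- which tends to zero at the end.
    have hex : ∀ t : ℝ, 0 < t → ∃ y ∈ feasible h,
        dist (x + t • d) y < Metric.infDist (x + t • d) (feasible h) + t * ε := fun t ht =>
      (Metric.infDist_lt_iff ⟨x, hx⟩).1 (lt_add_of_pos_right _ (by positivity))
    choose! y hyS hy using hex
    have hclose : ∀ᶠ t in 𝓝[>] (0 : ℝ), ‖y t - (x + t • d)‖ ≤ t * (κ * r t + ε) := by
      filter_upwards [self_mem_nhdsWithin, hray.eventually hbound] with t ht hb
      have ht : 0 < t := ht
      have h1 := hy t ht
      rw [dist_comm, dist_eq_norm] at h1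
      have h2 : ‖posEntries (h (x + t • d))‖ = t * r t := by
        simp only [hr, norm_smul, norm_inv, Real.norm_eq_abs, abs_of_pos ht]
        field_simp
      rw [h2] at hb
      linarith
    have hdist : ∀ᶠ t in 𝓝[>] (0 : ℝ), ‖y t - x‖ ≤ t * (‖d‖ + (κ * r t + ε)) := by
      filter_upwards [hclose, self_mem_nhdsWithin] with t hc ht
      have ht : 0 < t := ht
      have : y t - x = (y t - (x + t • d)) + t • d := by abel
      have h2 : ‖t • d‖ = t * ‖d‖ := by rw [norm_smul, Real.norm_eq_abs, abs_of_pos ht]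
      calc ‖y t - x‖ ≤ ‖y t - (x + t • d)‖ + ‖t • d‖ := by rw [this]; exact norm_add_le _ _
        _ ≤ t * (‖d‖ + (κ * r t + ε)) := by rw [h2]; linarith
    have hyx : Tendsto y (𝓝[>] 0) (𝓝 x) := by
      rw [tendsto_iff_norm_sub_tendsto_zero]
      have hub : Tendsto (fun t => t * (‖d‖ + (κ * r t + ε))) (𝓝[>] 0)
          (𝓝 (0 * (‖d‖ + (κ * q + ε)))) :=
        ht0.mul (((hrq.const_mul κ).add_const ε).const_add ‖d‖)
      rw [zero_mul] at hub
      exact squeeze_zero' (Eventually.of_forall fun _ => norm_nonneg _) hdist hub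
    have hlim : Tendsto (fun t => ‖v‖ * (κ * r t + ε) + ε * (‖d‖ + (κ * r t + ε))) (𝓝[>] 0)
        (𝓝 (‖v‖ * (κ * q + ε) + ε * (‖d‖ + (κ * q + ε)))) :=
      (((hrq.const_mul κ).add_const ε).const_mul ‖v‖).add
        ((((hrq.const_mul κ).add_const ε).const_add ‖d‖).const_mul ε)
    refine ge_of_tendsto hlim ?_
    filter_upwards [hclose, hdist, self_mem_nhdsWithin, hyx.eventually (hv ε hε)]
      with t hc hdt ht hvt
    have ht : 0 < t := ht
    have h1 := hvt (hyS t ht)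
    -- Normality controls the first term, the error bound the second.
    have h2 : inner ℝ v (t • d) = inner ℝ v (y t - x) - inner ℝ v (y t - (x + t • d)) := by
      rw [← inner_sub_right]; congr 1; abel
    have h3 : -inner ℝ v (y t - (x + t • d)) ≤ ‖v‖ * ‖y t - (x + t • d)‖ :=
      (neg_le_abs _).trans (abs_real_inner_le_norm _ _)
    have h4 := mul_le_mul_of_nonneg_left hc (norm_nonneg v)
    have h5 := mul_le_mul_of_nonneg_left hdt hε.le
    rw [inner_smul_right] at h2
    refine le_of_mul_le_mul_left ?_ ht
    linarith
  have hlim : Tendsto (fun ε : ℝ => ‖v‖ * (κ * q + ε) + ε * (‖d‖ + (κ * q + ε))) (𝓝[>] 0)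
      (𝓝 (‖v‖ * (κ * q + 0) + 0 * (‖d‖ + (κ * q + 0)))) :=
    ((ht0.const_add (κ * q)).const_mul ‖v‖).add (ht0.mul ((ht0.const_add (κ * q)).const_add ‖d‖))
  have := ge_of_tendsto hlim (by
    filter_upwards [self_mem_nhdsWithin] with ε hε using step ε hε)
  linarith

variable [CompleteSpace E]

/-- A vector whose pairing with every direction `d` is at most `c` times the norm of the active
positive part of `A d` is the image of a multiplier of norm at most `c`. -/
theorem exists_multiplier_of_inner_le (A : E →L[ℝ] EuclideanSpace ℝ ι) (u : EuclideanSpace ℝ ι)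
    {v : E} {c : ℝ} (hc : 0 ≤ c) (hv : ∀ d, inner ℝ v d ≤ c * ‖activePosEntries u (A d)‖) :
    ∃ y ∈ multipliers u, ‖y‖ ≤ c ∧ ContinuousLinearMap.adjoint A y = v := by
  set K := multipliers u ∩ Metric.closedBall 0 c with hK
  have hKc : IsCompact K :=
    (isCompact_closedBall 0 c).inter_left (isClosed_multipliers u)
  have hKconv : Convex ℝ K := (convex_multipliers u).inter (convex_closedBall 0 c)
  by_cases hmem : v ∈ ContinuousLinearMap.adjoint A '' K
  · obtain ⟨y, ⟨hy, hyc⟩, rfl⟩ := hmem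
    exact ⟨y, hy, by simpa using hyc, rfl⟩
  exfalso
  obtain ⟨f, s, hfs, hsv⟩ := geometric_hahn_banach_closed_point
    (hKconv.linear_image (ContinuousLinearMap.adjoint A).toLinearMap)
    (hKc.image (ContinuousLinearMap.adjoint A).continuous).isClosed hmem
  set d := (InnerProductSpace.toDual ℝ E).symm f with hdf
  have hfd : ∀ a, f a = inner ℝ d a := fun a => by
    rw [hdf, InnerProductSpace.toDual_symm_apply]
  set p := activePosEntries u (A d) with hp
  -- The maximizer of `f ∘ adjoint A` over `K`; when `p = 0` the convention `0⁻¹ = 0` gives `y = 0`,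
  -- still in `K`.
  set y := (c * ‖p‖⁻¹) • p with hy
  have hyK : y ∈ K := by
    refine ⟨fun i => ?_, ?_⟩
    · have := activePosEntries_mem_multipliers u (A d) i
      simp only [hy, PiLp.smul_apply, smul_eq_mul]
      exact ⟨mul_nonneg (by positivity) this.1, fun hi => by rw [hp, this.2 hi, mul_zero]⟩
    · rw [mem_closedBall_zero_iff, hy, norm_smul, Real.norm_eq_abs, abs_of_nonneg (by positivity),
        mul_assoc]
      exact mul_le_of_le_one_right hc (inv_mul_le_one)
  have h1 := hfs _ (Set.mem_image_of_mem _ hyK)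
  have h2 : f (ContinuousLinearMap.adjoint A y) = c * ‖p‖ := by
    rw [hfd, ContinuousLinearMap.adjoint_inner_right, hy, inner_smul_right, hp,
      inner_activePosEntries, ← hp]
    rcases eq_or_ne ‖p‖ 0 with h0 | h0
    · simp [h0]
    · field_simp
  have h3 : f v ≤ c * ‖p‖ := by
    rw [hfd, real_inner_comm]
    exact hv d
  have h4 : f (ContinuousLinearMap.adjoint A y) < s := h1
  linarith

theorem exists_multiplier_of_mem_regularNormalCone {h : E → EuclideanSpace ℝ ι} {x : E}
    (hx : x ∈ feasible h) (hd : DifferentiableAt ℝ h x) {κ : ℝ} (hκ : 0 ≤ κ)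
    (hbound : ∀ᶠ z in 𝓝 x, Metric.infDist z (feasible h) ≤ κ * ‖posEntries (h z)‖)
    {v : E} (hv : v ∈ regularNormalCone (feasible h) x) :
    ∃ y ∈ multipliers (h x), ‖y‖ ≤ κ * ‖v‖ ∧
      ContinuousLinearMap.adjoint (fderiv ℝ h x) y = v :=
  exists_multiplier_of_inner_le _ _ (by positivity)
    (inner_le_of_mem_regularNormalCone hx hd hbound hv)

/-- No error bound is needed: a multiplier pairs nonpositively with `h z - h x` for feasible `z`,
and linearization costs only `o(‖z - x‖)`. -/
theorem adjoint_image_multipliers_subset_regularNormalCone {h : E → EuclideanSpace ℝ ι} {x : E}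
    (hx : x ∈ feasible h) (hd : DifferentiableAt ℝ h x) :
    ContinuousLinearMap.adjoint (fderiv ℝ h x) '' multipliers (h x) ⊆
      regularNormalCone (feasible h) x := by
  rintro _ ⟨y, hy, rfl⟩
  rw [mem_regularNormalCone_iff]
  intro ε hε
  have hsmall := hd.hasFDerivAt.isLittleO.def (c := ε / (‖y‖ + 1)) (by positivity)
  filter_upwards [hsmall] with z hz hzS
  rw [ContinuousLinearMap.adjoint_inner_left]
  have h1 : inner ℝ y (h z - h x) ≤ 0 := by
    rw [PiLp.inner_apply]
    refine Finset.sum_nonpos fun i _ => ?_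
    simp only [RCLike.inner_apply, conj_trivial, PiLp.sub_apply]
    rcases (hx i).lt_or_eq with h' | h'
    · simp [(hy i).2 h']
    · rw [h', sub_zero]
      exact mul_nonpos_of_nonpos_of_nonneg (hzS i) (hy i).1
  have h2 : inner ℝ y (fderiv ℝ h x (z - x)) = inner ℝ y (h z - h x) -
      inner ℝ y (h z - h x - fderiv ℝ h x (z - x)) := by
    rw [← inner_sub_right]; congr 1; abel
  have h3 : -inner ℝ y (h z - h x - fderiv ℝ h x (z - x)) ≤
      ‖y‖ * ‖h z - h x - fderiv ℝ h x (z - x)‖ :=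
    (neg_le_abs _).trans (abs_real_inner_le_norm _ _)
  have h4 : ‖y‖ * ‖h z - h x - fderiv ℝ h x (z - x)‖ ≤
      ‖y‖ * (ε / (‖y‖ + 1) * ‖z - x‖) := mul_le_mul_of_nonneg_left hz (norm_nonneg _)
  have h5 : ‖y‖ * (ε / (‖y‖ + 1) * ‖z - x‖) ≤ ε * ‖z - x‖ := by
    rw [← mul_assoc]
    refine mul_le_mul_of_nonneg_right ?_ (norm_nonneg _)
    rw [mul_div_assoc', div_le_iff₀ (by positivity)]
    nlinarith
  linarith

theorem regularNormalCone_feasible {h : E → EuclideanSpace ℝ ι} {x : E}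
    (hx : x ∈ feasible h) (hd : DifferentiableAt ℝ h x) {κ : ℝ} (hκ : 0 ≤ κ)
    (hbound : ∀ᶠ z in 𝓝 x, Metric.infDist z (feasible h) ≤ κ * ‖posEntries (h z)‖) :
    regularNormalCone (feasible h) x =
      ContinuousLinearMap.adjoint (fderiv ℝ h x) '' multipliers (h x) := by
  refine Set.Subset.antisymm (fun v hv => ?_)
    (adjoint_image_multipliers_subset_regularNormalCone hx hd)
  obtain ⟨y, hy, -, hyv⟩ := exists_multiplier_of_mem_regularNormalCone hx hd hκ hbound hv
  exact ⟨y, hy, hyv⟩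

theorem limitingNormalCone_feasible {h : E → EuclideanSpace ℝ ι} {x : E}
    (hx : x ∈ feasible h) (hd : Differentiable ℝ h)
    (hcont : ContinuousAt (fun z => fderiv ℝ h z) x) {κ : ℝ} (hκ : 0 ≤ κ)
    (hbound : ∀ᶠ z in 𝓝 x, Metric.infDist z (feasible h) ≤ κ * ‖posEntries (h z)‖) :
    limitingNormalCone (feasible h) x =
      ContinuousLinearMap.adjoint (fderiv ℝ h x) '' multipliers (h x) := by
  refine Set.Subset.antisymm ?_ ((adjoint_image_multipliers_subset_regularNormalCone hx (hd x)).trans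
    (regularNormalCone_subset_limitingNormalCone hx))
  rintro v ⟨z, w, hz, hzS, hw, hwv⟩
  -- The error bound holds around each late `z k` with the same `κ`, so the multipliers chosen below
  -- are uniformly bounded.
  obtain ⟨N, hN⟩ := eventually_atTop.1 (hz.eventually hbound.eventually_nhds)
  have hz' : Tendsto (fun k => z (k + N)) atTop (𝓝 x) := (tendsto_add_atTop_iff_nat N).2 hz
  have hwv' : Tendsto (fun k => w (k + N)) atTop (𝓝 v) := (tendsto_add_atTop_iff_nat N).2 hwv
  choose y hy hyn hyw using fun k => exists_multiplier_of_mem_regularNormalCone (hzS (k + N))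
    (hd _) hκ (hN _ (Nat.le_add_left _ _)) (hw (k + N))
  obtain ⟨R, hR⟩ := (hwv'.norm.const_mul κ).bddAbove_range
  have hyR : ∀ k, y k ∈ Metric.closedBall 0 R := fun k =>
    mem_closedBall_zero_iff.2 ((hyn k).trans (hR ⟨k, rfl⟩))
  obtain ⟨a, -, σ, hσ, ha⟩ := (isCompact_closedBall 0 R).tendsto_subseq hyR
  have hzσ := hz'.comp hσ.tendsto_atTop
  refine ⟨a, mem_multipliers_of_tendsto (((hd x).continuousAt.tendsto).comp hzσ) ha
    fun k => hy (σ k), ?_⟩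
  have hadj : Tendsto (fun k => ContinuousLinearMap.adjoint (fderiv ℝ h (z (σ k + N)))) atTop
      (𝓝 (ContinuousLinearMap.adjoint (fderiv ℝ h x))) :=
    ((ContinuousLinearMap.adjoint (𝕜 := ℝ) (E := E)
      (F := EuclideanSpace ℝ ι)).continuous.tendsto _).comp (hcont.tendsto.comp hzσ)
  have happly := (isBoundedBilinearMap_apply (𝕜 := ℝ) (E := EuclideanSpace ℝ ι)
    (F := E)).continuous.tendsto (ContinuousLinearMap.adjoint (fderiv ℝ h x), a)
  refine tendsto_nhds_unique (happly.comp (hadj.prodMk_nhds ha)) ?_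
  refine (hwv'.comp hσ.tendsto_atTop).congr fun k => ?_
  exact (hyw (σ k)).symm

end ConstraintSystem

/-! ### Jumps of the zero-one loss -/

section ZeroOneSum

variable {m : ℕ}

theorem zeroOneSum_eq_of_pos_of_nonpos {u u₀ : EuclideanSpace ℝ (Fin m)}
    (hpos : ∀ i ∈ posIdx u₀, 0 < u i) (hnonpos : ∀ i ∉ posIdx u₀, u i ≤ 0) :
    zeroOneSum u = zeroOneSum u₀ := by
  refine Finset.sum_congr rfl fun i _ => ?_
  by_cases hi : i ∈ posIdx u₀
  · have h₀ : 0 < u₀ i := by simpa [posIdx] using hi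
    simp [zeroOne, hpos i hi, h₀]
  · have h₀ : ¬ 0 < u₀ i := by simpa [posIdx] using hi
    simp [zeroOne, (hnonpos i hi).not_gt, h₀]

theorem zeroOneSum_add_one_le {u u₀ : EuclideanSpace ℝ (Fin m)}
    (hpos : ∀ i ∈ posIdx u₀, 0 < u i) {j : Fin m} (hj : j ∉ posIdx u₀) (huj : 0 < u j) :
    zeroOneSum u₀ + 1 ≤ zeroOneSum u := by
  have hle : ∀ i, zeroOne (u₀ i) + (if i = j then 1 else 0) ≤ zeroOne (u i) := by
    intro i
    by_cases hi : i ∈ posIdx u₀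
    · have h₀ : 0 < u₀ i := by simpa [posIdx] using hi
      have hij : i ≠ j := fun h => hj (h ▸ hi)
      simp [zeroOne, hpos i hi, h₀, hij]
    · have h₀ : ¬ 0 < u₀ i := by simpa [posIdx] using hi
      by_cases hij : i = j
      · subst hij
        simp [zeroOne, huj, h₀]
      · simp only [zeroOne, h₀, hij, if_false, add_zero]
        split_ifs <;> norm_num
  calc zeroOneSum u₀ + 1 = ∑ i, (zeroOne (u₀ i) + if i = j then 1 else 0) := by
        simp [zeroOneSum, Finset.sum_add_distrib]
    _ ≤ zeroOneSum u := Finset.sum_le_sum fun i _ => hle i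

/-- Near `x`, the loss `C * zeroOneSum (g z)` is constant where the constraints that hold at `x`
persist, and jumps by at least `C` elsewhere. -/
theorem eventually_zeroOneSum_jump {X : Type*} [TopologicalSpace X] {C : ℝ} (hC : 0 < C)
    {g : X → EuclideanSpace ℝ (Fin m)} {x : X} (hg : ContinuousAt g x) :
    ∀ᶠ z in 𝓝 x,
      (z ∈ feasible (fun z => subvec (posIdx (g x))ᶜ (g z)) →
        C * zeroOneSum (g z) = C * zeroOneSum (g x)) ∧
      (z ∉ feasible (fun z => subvec (posIdx (g x))ᶜ (g z)) →
        C * zeroOneSum (g x) + C ≤ C * zeroOneSum (g z)) := by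
  have hpos : ∀ᶠ z in 𝓝 x, ∀ i ∈ posIdx (g x), 0 < g z i := by
    rw [Filter.eventually_all_finset]
    intro i hi
    have h₀ : 0 < g x i := by simpa [posIdx] using hi
    exact (((EuclideanSpace.proj (𝕜 := ℝ) i).continuous.tendsto _).comp
      hg.tendsto).eventually_const_lt h₀
  filter_upwards [hpos] with z hz
  constructor
  · intro hzΘ
    rw [zeroOneSum_eq_of_pos_of_nonpos hz fun i hi => hzΘ ⟨i, Finset.mem_compl.2 hi⟩]
  · intro hzΘ
    obtain ⟨⟨j, hj⟩, hjz⟩ := not_forall.1 hzΘ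
    have := zeroOneSum_add_one_le hz (Finset.mem_compl.1 hj) (not_le.1 hjz)
    nlinarith

end ZeroOneSum

/-! ### From metric subregularity to an error bound -/

section Subregularity

variable {E : Type*} [NormedAddCommGroup E]
variable {ι : Type*} [Fintype ι]

/-- Metric subregularity of `z ↦ h z - ℝ₋^ι` for the origin is a local error bound. -/
theorem MetricallySubregularAt.exists_errorBound {h : E → EuclideanSpace ℝ ι} {x : E}
    (H : MetricallySubregularAt (fun z => {p | ∃ w ∈ nonposOrthant ι, p = h z - w}) x 0) :
    ∃ κ : ℝ, 0 ≤ κ ∧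
      ∀ᶠ z in 𝓝 x, Metric.infDist z (feasible h) ≤ κ * ‖posEntries (h z)‖ := by
  obtain ⟨-, κ, hκ, δ, hδ, hbound⟩ := H
  refine ⟨κ, hκ, ?_⟩
  filter_upwards [Metric.ball_mem_nhds x hδ] with z hz
  have hset : {y | (0 : EuclideanSpace ℝ ι) ∈ {p | ∃ w ∈ nonposOrthant ι, p = h y - w}} =
      feasible h := by
    ext y
    constructor
    · rintro ⟨w, hw, hy⟩
      have hyw : h y = w := sub_eq_zero.1 hy.symm
      exact fun i => hyw ▸ hw i
    · exact fun hy => ⟨h y, hy, (sub_self _).symm⟩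
  -- Taking `w = min (h z) 0` entrywise bounds `dist(0, G z)` by the norm of the positive part.
  have hmem : posEntries (h z) ∈ {p | ∃ w ∈ nonposOrthant ι, p = h z - w} :=
    ⟨h z - posEntries (h z), fun i => by simp [posEntries], (sub_sub_cancel _ _).symm⟩
  have h1 := hbound z hz ⟨_, hmem⟩
  rw [hset] at h1
  refine h1.trans (mul_le_mul_of_nonneg_left ?_ hκ)
  simpa using Metric.infDist_le_dist_of_mem (x := 0) hmem

end Subregularity

end ZeroOneLoss

theorem mainTheorem4 {l m : ℕ} (C : ℝ) (hC : 0 < C)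
    (g : EuclideanSpace ℝ (Fin l) → EuclideanSpace ℝ (Fin m)) (hg : Differentiable ℝ g)
    (zbar : EuclideanSpace ℝ (Fin l)) :
    let φ : EuclideanSpace ℝ (Fin l) → ℝ := fun z => C * ZeroOneLoss.zeroOneSum (g z)
    let I : Finset (Fin m) := ZeroOneLoss.posIdx (g zbar)
    let gJ : EuclideanSpace ℝ (Fin l) → EuclideanSpace ℝ (Iᶜ : Finset (Fin m)) :=
      fun z => ZeroOneLoss.subvec Iᶜ (g z)
    let Θ : Set (EuclideanSpace ℝ (Fin l)) := {z | ∀ i, gJ z i ≤ 0}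
    let G : EuclideanSpace ℝ (Fin l) → Set (EuclideanSpace ℝ (Iᶜ : Finset (Fin m))) :=
      fun z => {p | ∃ w ∈ ZeroOneLoss.nonposOrthant (Iᶜ : Finset (Fin m)), p = gJ z - w}
    let M : Set (EuclideanSpace ℝ (Fin l)) :=
      ZeroOneLoss.gradMap gJ zbar ''
        ZeroOneLoss.limitingNormalCone
          (ZeroOneLoss.nonposOrthant (Iᶜ : Finset (Fin m))) (gJ zbar)
    (ZeroOneLoss.regularSubdiff φ zbar = ZeroOneLoss.regularNormalCone Θ zbar ∧
      ZeroOneLoss.limitingSubdiff φ zbar = ZeroOneLoss.limitingNormalCone Θ zbar) ∧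
    (ZeroOneLoss.MetricallySubregularAt G zbar 0 →
      ZeroOneLoss.regularSubdiff φ zbar = M ∧
      (ContinuousAt (fun z => fderiv ℝ gJ z) zbar →
        ZeroOneLoss.limitingSubdiff φ zbar = M)) := by
  intro φ I gJ Θ G M
  have hgJ : Differentiable ℝ gJ := by
    rw [differentiable_euclidean]
    exact fun i => differentiable_euclidean.1 hg i
  have hz : zbar ∈ ZeroOneLoss.feasible gJ := fun i => by
    have := Finset.mem_compl.1 i.2
    simpa [I, ZeroOneLoss.posIdx, gJ, ZeroOneLoss.subvec] using this
  have hM : M = ContinuousLinearMap.adjoint (fderiv ℝ gJ zbar) ''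
      ZeroOneLoss.multipliers (gJ zbar) := by
    simp only [M, ZeroOneLoss.limitingNormalCone_nonposOrthant (u := gJ zbar) hz]
    rfl
  -- The set `feasible` appearing here is `Θ` by definition, with jump height `C`.
  have hjump := ZeroOneLoss.eventually_zeroOneSum_jump hC (hg zbar).continuousAt
  have hreg : ZeroOneLoss.regularSubdiff φ zbar = ZeroOneLoss.regularNormalCone Θ zbar :=
    ZeroOneLoss.regularSubdiff_eq_regularNormalCone_of_jump hC hjump
  have hlim : ZeroOneLoss.limitingSubdiff φ zbar = ZeroOneLoss.limitingNormalCone Θ zbar :=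
    ZeroOneLoss.limitingSubdiff_eq_limitingNormalCone_of_jump hC hjump
  refine ⟨⟨hreg, hlim⟩, fun hsub => ?_⟩
  obtain ⟨κ, hκ, hbound⟩ := hsub.exists_errorBound
  rw [hreg, hlim, hM]
  exact ⟨ZeroOneLoss.regularNormalCone_feasible hz (hgJ zbar) hκ hbound, fun hcont =>
    ZeroOneLoss.limitingNormalCone_feasible hz hgJ hcont hκ hbound⟩
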